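/- Let $K$ be a field, $n\ge m\ge 1$ and $t\ge 1$ integers, and $S=K[x_1,\ldots,x_n]$ with its $\mathbb Z^n$-grading. Let $$I_{n,m}=(x_1x_2\cdots x_m,\;x_2x_3\cdots x_{m+1},\;\ldots,\;x_{n-m+1}\cdots x_n)\subset S$$ be the $m$-path ideal of the path graph on $n$ vertices, and put $t_0=\min\{t,n-m\}$. For a nonzero monomial ideal $I\subset S$, a Stanley decomposition of $I$ is a finite direct sum decomposition $\mathcal D: I=\bigoplus_{i=1}^r u_iK[Z_i]$ of $K$-vector spaces, where each $u_i\in I$ is nonzero and homogeneous for the $\mathbb Z^n$-grading (a nonzero scalar times a monomial) and $Z_i\subset\{x_1,\ldots,x_n\}$. Put $\operatorname{sdepth}(\mathcal D)=\min_i|Z_i|$, and let the Stanley depth $\operatorname{sdepth}(I)$ be the maximum of $\operatorname{sdepth}(\mathcal D)$ over all Stanley decompositions $\mathcal D$ of $I$. Then $$\operatorname{sdepth}(I_{n,m}^t)\;\le\;\min\left\{\,n-\left\lceil\frac{t_0}{2}\right\rceil,\;\; n-\left\lfloor\frac{n-t_0+1}{m+1}\right\rfloor+1\right\}.$$ -/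

import Mathlib

/-- The `K`-subspace `u K[Z] = {u p : p ∈ K[Z]}` of `K[x_i : i ∈ σ]`, where `K[Z]` is the polynomial
ring in the variables `x_j`, `j ∈ Z`. -/
noncomputable def stanleySpace {σ K : Type*} [Field K] (u : MvPolynomial σ K) (Z : Finset σ) :
    Submodule K (MvPolynomial σ K) :=
  (Subalgebra.toSubmodule (MvPolynomial.supported K (Z : Set σ))).map (LinearMap.mulLeft K u)

/-- A Stanley decomposition `I = u_1 K[Z_1] ⊕ ⋯ ⊕ u_r K[Z_r]` of an ideal `I` of the polynomial ring
`K[x_i : i ∈ σ]`, with its fine (one degree per variable) grading. The nonzero homogeneous elements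
of this grading are the terms `c x^a` with `c ≠ 0`. As the polynomial ring is a domain, `u K[Z]` is a
free `K[Z]`-module exactly when `u ≠ 0`. -/
structure StanleyDecomposition {σ K : Type*} [Field K] (I : Ideal (MvPolynomial σ K)) where
  /-- the number of summands -/
  r : ℕ
  /-- the homogeneous generators -/
  u : Fin r → MvPolynomial σ K
  /-- the sets of variables -/
  Z : Fin r → Finset σ
  mem : ∀ i, u i ∈ I
  homogeneous : ∀ i, ∃ (a : σ →₀ ℕ) (c : K), c ≠ 0 ∧ u i = MvPolynomial.monomial a c
  independent : iSupIndep fun i => stanleySpace (u i) (Z i)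
  sum_eq : ⨆ i, stanleySpace (u i) (Z i) = I.restrictScalars K

/-- The Stanley depth `min_i |Z_i|` of a Stanley decomposition (of a nonzero ideal, so that the
decomposition has at least one summand). -/
noncomputable def StanleyDecomposition.sdepth {σ K : Type*} [Field K]
    {I : Ideal (MvPolynomial σ K)} (D : StanleyDecomposition I) : ℕ :=
  ⨅ i, (D.Z i).card

/-- The values `D.sdepth` are bounded by the number of variables, so that the supremum defining the
Stanley depth of an ideal is a maximum whenever a Stanley decomposition exists. -/
theorem StanleyDecomposition.bddAbove_sdepth {σ K : Type*} [Fintype σ] [Field K]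
    (I : Ideal (MvPolynomial σ K)) :
    BddAbove (Set.range fun D : StanleyDecomposition I => D.sdepth) := by
  refine ⟨Fintype.card σ, ?_⟩
  rintro _ ⟨D, rfl⟩
  show (⨅ i, (D.Z i).card) ≤ _
  rcases isEmpty_or_nonempty (Fin D.r) with h | ⟨⟨i⟩⟩
  · simp
  · exact (ciInf_le (OrderBot.bddBelow _) i).trans (Finset.card_le_univ _)

/-- The Stanley depth of a (nonzero monomial) ideal `I`, regarded as a multigraded module: the
maximum of the Stanley depths of its Stanley decompositions. -/
noncomputable def stanleyDepth {σ K : Type*} [Field K] (I : Ideal (MvPolynomial σ K)) : ℕ :=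
  ⨆ D : StanleyDecomposition I, D.sdepth

/-- The `m`-path ideal `I_{n,m}` of the path graph on `n` vertices: it is generated by the products
of `m` consecutive variables. The variables `x_1, …, x_n` are indexed by `Fin n` (from `0`), and the
generator that starts at position `i` is `x_i x_{i+1} ⋯ x_{i+m-1}`. -/
noncomputable def pathIdeal (K : Type*) [Field K] (n m : ℕ) : Ideal (MvPolynomial (Fin n) K) :=
  Ideal.span {f | ∃ i : ℕ, i + m ≤ n ∧
    f = ∏ k ∈ (Finset.univ : Finset (Fin n)).filter (fun k => i ≤ k.val ∧ k.val < i + m),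
      MvPolynomial.X k}

/-! A Stanley decomposition partitions the monomials of the ideal into blocks. Let a monomial `w`
times any transversal of disjoint sets `C i` lie in the ideal, while removing one transversal
variable always leaves it. Join transversals that differ in one place. If a block were free in the
incoming variable at both ends of an edge, the lcm would put both ends in one block, which would
then contain their gcd, a monomial outside the ideal. So at most half of all directed edges are
free, and some block misses many variables. This is `StanleyDecomposition.two_mul_sdepth_le`.

It is applied twice. With `C i` the residue classes mod `m` among the first `t₀ + m` variables it
gives the bound with `t₀ / 2`. With a single set `P`, two variables out of every `m + 1`, it gives
`n - n / (m + 1)`, which implies the other bound. Leaving the ideal is detected by degree: every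
window meets the chosen set, so `t`-th powers have degree at least `t` there. -/

open Finset

/-! ### The monomials of a Stanley decomposition -/

/-- The exponents of the monomials in `x^a K[Z]`. -/
def stanleyExponents {σ : Type*} (a : σ →₀ ℕ) (Z : Finset σ) : Set (σ →₀ ℕ) :=
  {b | ∀ k, a k ≤ b k ∧ (k ∉ Z → b k = a k)}

theorem stanleySpace_le_restrictSupport {σ K : Type*} [Field K] (a : σ →₀ ℕ) (c : K)
    (Z : Finset σ) :
    stanleySpace (MvPolynomial.monomial a c) Z ≤
      MvPolynomial.restrictSupport K (stanleyExponents a Z) := by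
  classical
  rintro _ ⟨p, hp, rfl⟩
  rw [MvPolynomial.mem_restrictSupport_iff]
  intro b hb
  have hb' : b ∈ (MvPolynomial.monomial a c * p).support := hb
  rw [MvPolynomial.mem_support_iff, MvPolynomial.coeff_monomial_mul'] at hb'
  split_ifs at hb' with hab
  · have hp' : p ∈ MvPolynomial.supported K (Z : Set σ) := hp
    rw [MvPolynomial.mem_supported] at hp'
    have hs : b - a ∈ p.support := MvPolynomial.mem_support_iff.2 (right_ne_zero_of_mul hb')
    intro k
    refine ⟨hab k, fun hk => ?_⟩
    by_contra hne
    apply hk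
    apply hp'
    rw [Finset.mem_coe, MvPolynomial.mem_vars_iff_mem_support]
    refine ⟨_, hs, ?_⟩
    have := hab k
    simp only [Finsupp.mem_support_iff, Finsupp.coe_tsub, Pi.sub_apply]
    omega
  · exact absurd rfl hb'

theorem monomial_mem_stanleySpace {σ K : Type*} [Field K] {a b : σ →₀ ℕ} {c : K} (hc : c ≠ 0)
    {Z : Finset σ} (hb : b ∈ stanleyExponents a Z) :
    MvPolynomial.monomial b 1 ∈ stanleySpace (MvPolynomial.monomial a c) Z := by
  refine ⟨MvPolynomial.monomial (b - a) c⁻¹, ?_, ?_⟩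
  · change _ ∈ MvPolynomial.supported K (Z : Set σ)
    rw [MvPolynomial.mem_supported, MvPolynomial.vars_monomial (inv_ne_zero hc)]
    intro k hk
    by_contra hkZ
    have := (hb k).2 hkZ
    simp [this] at hk
  · rw [LinearMap.mulLeft_apply, MvPolynomial.monomial_mul, mul_inv_cancel₀ hc,
      add_tsub_cancel_of_le fun k => (hb k).1]

/-- A Stanley decomposition partitions the exponents of the monomials in the ideal. -/
theorem StanleyDecomposition.exists_partition {σ K : Type*} [Field K]
    {I : Ideal (MvPolynomial σ K)} (D : StanleyDecomposition I) :
    ∃ a : Fin D.r → (σ →₀ ℕ),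
      (∀ b, MvPolynomial.monomial b 1 ∈ I ↔ ∃ p, b ∈ stanleyExponents (a p) (D.Z p)) ∧
      ∀ b p q, b ∈ stanleyExponents (a p) (D.Z p) → b ∈ stanleyExponents (a q) (D.Z q) →
        p = q := by
  choose a c hc hu using D.homogeneous
  have hmem : ∀ b p, b ∈ stanleyExponents (a p) (D.Z p) →
      MvPolynomial.monomial b 1 ∈ stanleySpace (D.u p) (D.Z p) := by
    intro b p h
    rw [hu]
    exact monomial_mem_stanleySpace (hc p) h
  refine ⟨a, fun b => ⟨fun hb => ?_, ?_⟩, ?_⟩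
  · have hle : ⨆ i, stanleySpace (D.u i) (D.Z i) ≤
        MvPolynomial.restrictSupport K (⋃ p, stanleyExponents (a p) (D.Z p)) := by
      refine iSup_le fun p => ?_
      rw [hu]
      exact (stanleySpace_le_restrictSupport _ _ _).trans
        (MvPolynomial.restrictSupport_mono _ (Set.subset_iUnion_of_subset p subset_rfl))
    have hb' : MvPolynomial.monomial b (1 : K) ∈ ⨆ i, stanleySpace (D.u i) (D.Z i) := by
      rw [D.sum_eq]; exact hb
    have h := (MvPolynomial.mem_restrictSupport_iff K).1 (hle hb')
    have hbs : b ∈ (MvPolynomial.monomial b (1 : K)).support := by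
      classical
      rw [MvPolynomial.mem_support_iff, MvPolynomial.coeff_monomial, if_pos rfl]
      exact one_ne_zero
    simpa using h hbs
  · rintro ⟨p, hp⟩
    have h := Submodule.mem_iSup_of_mem (p := fun i => stanleySpace (D.u i) (D.Z i)) p
      (hmem b p hp)
    rw [D.sum_eq] at h
    exact h
  · intro b p q hp hq
    by_contra hne
    have h := Submodule.disjoint_def.1 (D.independent.pairwiseDisjoint hne) _
      (hmem b p hp) (hmem b q hq)
    exact one_ne_zero (MvPolynomial.monomial_eq_zero.1 h)

/-! ### The counting bound -/

/-- Inclusion-exclusion for `Z` and the union of the `C i`: a variable in both is some `f i` or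
gives a free pair. -/
theorem card_filter_pairs {σ ι : Type*} [Fintype σ] [DecidableEq σ] [Fintype ι] [DecidableEq ι]
    (C : ι → Finset σ) (hdisj : ∀ i j, i ≠ j → Disjoint (C i) (C j)) (f : ι → σ)
    (Z : Finset σ) :
    Z.card + ∑ i, (C i).card ≤ Fintype.card σ + Fintype.card ι +
      ((univ : Finset (ι × σ)).filter fun x => x.2 ∈ C x.1 ∧ x.2 ≠ f x.1 ∧ x.2 ∈ Z).card := by
  have h1 : (univ.biUnion C).card = ∑ i, (C i).card :=
    Finset.card_biUnion fun i _ j _ h => hdisj i j h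
  have h2 := Finset.card_union_add_card_inter Z (univ.biUnion C)
  have h3 : (Z ∪ univ.biUnion C).card ≤ Fintype.card σ := Finset.card_le_univ _
  have h4 : Z ∩ univ.biUnion C ⊆ (univ.image f) ∪
      ((univ : Finset (ι × σ)).filter
        fun x => x.2 ∈ C x.1 ∧ x.2 ≠ f x.1 ∧ x.2 ∈ Z).image Prod.snd := by
    intro j hj
    simp only [mem_inter, mem_biUnion, mem_univ, true_and] at hj
    obtain ⟨hjZ, i, hi⟩ := hj
    by_cases h : j = f i
    · exact mem_union_left _ (mem_image.2 ⟨i, mem_univ _, h.symm⟩)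
    · exact mem_union_right _ (mem_image.2 ⟨(i, j), by simp [hi, h, hjZ], rfl⟩)
  have h5 := (Finset.card_le_card h4).trans (Finset.card_union_le _ _)
  have h6 : (univ.image f).card ≤ Fintype.card ι := Finset.card_image_le
  have h7 := Finset.card_image_le (s := (univ : Finset (ι × σ)).filter
    fun x => x.2 ∈ C x.1 ∧ x.2 ≠ f x.1 ∧ x.2 ∈ Z) (f := Prod.snd)
  omega

theorem card_filter_pairs_add {σ ι : Type*} [Fintype σ] [DecidableEq σ] [Fintype ι]
    [DecidableEq ι] (C : ι → Finset σ) (f : ι → σ) (hf : ∀ i, f i ∈ C i) :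
    ((univ : Finset (ι × σ)).filter fun x => x.2 ∈ C x.1 ∧ x.2 ≠ f x.1).card + Fintype.card ι =
      ∑ i, (C i).card := by
  have h : ((univ : Finset (ι × σ)).filter fun x => x.2 ∈ C x.1 ∧ x.2 ≠ f x.1) =
      (univ.sigma fun i => (C i).erase (f i)).map (Equiv.sigmaEquivProd ι σ).toEmbedding := by
    ext ⟨i, j⟩
    simp [and_comm]
  rw [h, card_map, card_sigma, ← Finset.card_univ, Finset.card_eq_sum_ones, ← sum_add_distrib]
  exact sum_congr rfl fun i _ => card_erase_add_one (hf i)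

/-- If `w` times every transversal of the disjoint sets of variables `C i` lies in `I`, but `w`
times a partial transversal never does, then the sizes of the `C i` bound the Stanley depth. -/
theorem StanleyDecomposition.two_mul_sdepth_le {σ ι K : Type*} [Fintype σ] [Fintype ι] [Field K]
    {I : Ideal (MvPolynomial σ K)} (D : StanleyDecomposition I) (C : ι → Finset σ)
    (hdisj : ∀ i j, i ≠ j → Disjoint (C i) (C j)) (hne : ∀ i, (C i).Nonempty) (w : σ →₀ ℕ)
    (hin : ∀ f : ι → σ, (∀ i, f i ∈ C i) →
      MvPolynomial.monomial (w + ∑ i, Finsupp.single (f i) 1) 1 ∈ I)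
    (hout : ∀ (f : ι → σ) (v : σ →₀ ℕ) (i : ι), (∀ i, f i ∈ C i) →
      w + ∑ i, Finsupp.single (f i) 1 = v + Finsupp.single (f i) 1 →
      MvPolynomial.monomial v 1 ∉ I) :
    2 * D.sdepth + ∑ i, (C i).card ≤ 2 * Fintype.card σ + Fintype.card ι := by
  classical
  obtain ⟨a, hA, huniq⟩ := D.exists_partition
  have hp : ∀ f : ι → σ, ∃ p : Fin D.r, (∀ i, f i ∈ C i) →
      w + ∑ i, Finsupp.single (f i) 1 ∈ stanleyExponents (a p) (D.Z p) := by
    -- A transversal exists, so there is a block `p₀` to serve as junk value off the transversals.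
    obtain ⟨f₀, hf₀⟩ : ∃ f₀ : ι → σ, ∀ i, f₀ i ∈ C i := Classical.axiom_of_choice hne
    obtain ⟨p₀, -⟩ := (hA _).1 (hin f₀ hf₀)
    intro f
    by_cases hf : ∀ i, f i ∈ C i
    · obtain ⟨p, hp⟩ := (hA _).1 (hin f hf)
      exact ⟨p, fun _ => hp⟩
    · exact ⟨p₀, fun h => absurd h hf⟩
  choose p hp using hp
  let T := Fintype.piFinset C
  have hT : ∀ f, f ∈ T ↔ ∀ i, f i ∈ C i := fun f => Fintype.mem_piFinset
  let X := T.sigma fun f => (univ : Finset (ι × σ)).filter fun x => x.2 ∈ C x.1 ∧ x.2 ≠ f x.1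
  let G := T.sigma fun f => (univ : Finset (ι × σ)).filter
    fun x => x.2 ∈ C x.1 ∧ x.2 ≠ f x.1 ∧ x.2 ∈ D.Z (p f)
  -- `(f, i, j)` is the directed edge replacing `f i` by `j`; `τ` reverses it.
  let τ : (Σ _ : ι → σ, ι × σ) → (Σ _ : ι → σ, ι × σ) := fun y =>
    ⟨Function.update y.1 y.2.1 y.2.2, (y.2.1, y.1 y.2.1)⟩
  have hττ : ∀ y, τ (τ y) = y := by
    rintro ⟨f, i, j⟩
    simp [τ]
  have hτX : ∀ y ∈ X, τ y ∈ X := by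
    rintro ⟨f, i, j⟩ hy
    simp only [X, τ, mem_sigma, mem_filter, mem_univ, true_and, hT] at hy ⊢
    obtain ⟨hf, hj, hjne⟩ := hy
    refine ⟨fun l => ?_, hf i, by simpa using hjne.symm⟩
    by_cases hl : l = i
    · subst hl; simpa using hj
    · simpa [hl] using hf l
  have hGX : G ⊆ X := by
    rintro ⟨f, i, j⟩ hy
    simp only [X, G, mem_sigma, mem_filter, mem_univ, true_and] at hy ⊢
    exact ⟨hy.1, hy.2.1, hy.2.2.1⟩
  have hGG : Disjoint G (G.image τ) := by
    rw [Finset.disjoint_left]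
    rintro y hy hy'
    obtain ⟨z, hz, rfl⟩ := mem_image.1 hy'
    obtain ⟨f, i, j⟩ := z
    simp only [G, τ, mem_sigma, mem_filter, mem_univ, true_and, hT] at hy hz
    obtain ⟨hf, hj, hjne, hjZ⟩ := hz
    obtain ⟨hf', -, -, hjZ'⟩ := hy
    set f' := Function.update f i j with hf'def
    have hF := hp f hf
    have hF' := hp f' hf'
    set v := w + ∑ l ∈ univ.erase i, Finsupp.single (f l) 1 with hv
    have e1 : w + ∑ l, Finsupp.single (f l) 1 = v + Finsupp.single (f i) 1 := by
      rw [hv, add_assoc, Finset.sum_erase_add _ _ (mem_univ i)]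
    have e2 : w + ∑ l, Finsupp.single (f' l) 1 = v + Finsupp.single j 1 := by
      rw [hv, add_assoc, ← Finset.sum_erase_add _ _ (mem_univ i)]
      have : f' i = j := by simp [hf'def]
      rw [this]
      congr 2
      refine sum_congr rfl fun l hl => ?_
      rw [hf'def, Function.update_of_ne (ne_of_mem_erase hl)]
    rw [e1] at hF
    rw [e2] at hF'
    have hpq : p f = p f' := by
      -- The lcm of the two endpoints lies in both blocks.
      refine huniq (v + Finsupp.single (f i) 1 + Finsupp.single j 1) _ _ ?_ ?_
      · intro k
        have hk := hF k
        simp only [Finsupp.coe_add, Pi.add_apply] at hk ⊢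
        refine ⟨by omega, fun hkZ => ?_⟩
        have : j ≠ k := fun h => hkZ (h ▸ hjZ)
        rw [Finsupp.single_eq_of_ne' this, hk.2 hkZ, add_zero]
      · intro k
        have hk := hF' k
        simp only [Finsupp.coe_add, Pi.add_apply] at hk ⊢
        refine ⟨by omega, fun hkZ => ?_⟩
        have : f i ≠ k := fun h => hkZ (h ▸ hjZ')
        rw [Finsupp.single_eq_of_ne' this, ← hk.2 hkZ, add_zero]
    rw [← hpq] at hF' hjZ'
    -- A block is closed under gcd, and the gcd of the endpoints is `v`.
    refine hout f v i hf e1 ((hA v).2 ⟨p f, fun k => ?_⟩)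
    have h1 := hF k
    have h2 := hF' k
    simp only [Finsupp.coe_add, Pi.add_apply, Finsupp.single_apply] at h1 h2
    split_ifs at h1 h2 with g1 g2 g2
    · exact absurd (g2.trans g1.symm) hjne
    · exact ⟨by omega, fun h => by have := h2.2 h; omega⟩
    · exact ⟨by omega, fun h => by have := h1.2 h; omega⟩
    · exact ⟨by omega, fun h => by have := h1.2 h; omega⟩
  have hcard : 2 * G.card ≤ X.card := by
    have h1 : (G.image τ).card = G.card :=
      Finset.card_image_of_injective _ (Function.LeftInverse.injective hττ)
    have h2 : G ∪ G.image τ ⊆ X :=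
      union_subset hGX (image_subset_iff.2 fun y hy => hτX y (hGX hy))
    have h3 := card_le_card h2
    rw [card_union_of_disjoint hGG] at h3
    omega
  rw [card_sigma, card_sigma, mul_sum] at hcard
  have hTne : T.Nonempty := Fintype.piFinset_nonempty.2 hne
  -- By averaging, some transversal has at most half of its outgoing edges free.
  obtain ⟨f, hf, hle⟩ := Finset.exists_le_of_sum_le hTne hcard
  rw [hT] at hf
  have h1 := card_filter_pairs C hdisj f (D.Z (p f))
  have h2 := card_filter_pairs_add C f hf
  have h3 : D.sdepth ≤ (D.Z (p f)).card := ciInf_le (OrderBot.bddBelow _) (p f)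
  omega

theorem stanleyDepth_le_of_forall {σ K : Type*} [Field K] {I : Ideal (MvPolynomial σ K)} {d : ℕ}
    (h : ∀ D : StanleyDecomposition I, D.sdepth ≤ d) : stanleyDepth I ≤ d :=
  ciSup_le' h

theorem StanleyDecomposition.sdepth_le_card {σ K : Type*} [Fintype σ] [Field K]
    {I : Ideal (MvPolynomial σ K)} (D : StanleyDecomposition I) : D.sdepth ≤ Fintype.card σ := by
  change (⨅ i, (D.Z i).card) ≤ _
  rcases isEmpty_or_nonempty (Fin D.r) with h | ⟨⟨i⟩⟩
  · simp
  · exact (ciInf_le (OrderBot.bddBelow _) i).trans (Finset.card_le_univ _)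

/-! ### Monomials in powers of the path ideal -/

/-- The exponent of the `j`-th variable, and `0` if there is no such variable. -/
noncomputable def varExp (n j : ℕ) : Fin n →₀ ℕ :=
  if h : j < n then Finsupp.single ⟨j, h⟩ 1 else 0

theorem varExp_apply (n j : ℕ) (k : Fin n) : varExp n j k = if j = k then 1 else 0 := by
  unfold varExp
  split_ifs with h1 h2 h2
  · rw [show (⟨j, h1⟩ : Fin n) = k from Fin.ext h2, Finsupp.single_eq_same]
  · exact Finsupp.single_eq_of_ne' fun h => h2 (congrArg Fin.val h)
  · exact absurd (h2 ▸ k.2) h1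
  · rfl

theorem varExp_val {n : ℕ} (k : Fin n) : varExp n k = Finsupp.single k 1 := by
  simp [varExp]

/-- The exponent of `x_i x_{i+1} ⋯ x_{i+m-1}`. -/
noncomputable def windowExp (n m i : ℕ) : Fin n →₀ ℕ :=
  ∑ j ∈ range m, varExp n (i + j)

theorem windowExp_eq_sum_Ico (n m i : ℕ) : windowExp n m i = ∑ j ∈ Ico i (i + m), varExp n j := by
  rw [windowExp, Finset.sum_Ico_eq_sum_range, add_tsub_cancel_left]

theorem windowExp_apply (n m i : ℕ) (k : Fin n) :
    windowExp n m i k = if i ≤ k ∧ (k : ℕ) < i + m then 1 else 0 := by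
  rw [windowExp_eq_sum_Ico, Finsupp.finsetSum_apply]
  simp [varExp_apply]

theorem windowExp_succ_add (n m i : ℕ) :
    windowExp n m (i + 1) + varExp n i = windowExp n m i + varExp n (i + m) := by
  have h1 := Finset.sum_range_succ (fun j => varExp n (i + j)) m
  have h2 := Finset.sum_range_succ' (fun j => varExp n (i + j)) m
  rw [h1] at h2
  simp only [add_zero] at h2
  rw [windowExp, windowExp, h2]
  simp only [add_assoc, add_comm 1]

theorem monomial_mem_mono {σ K : Type*} [Field K] {I : Ideal (MvPolynomial σ K)} {a b : σ →₀ ℕ}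
    (h : MvPolynomial.monomial a 1 ∈ I) (hab : a ≤ b) : MvPolynomial.monomial b 1 ∈ I := by
  have : MvPolynomial.monomial b (1 : K) =
      MvPolynomial.monomial (b - a) 1 * MvPolynomial.monomial a 1 := by
    rw [MvPolynomial.monomial_mul, one_mul, tsub_add_cancel_of_le hab]
  rw [this]
  exact I.mul_mem_left _ h

theorem monomial_add_mem_pow {σ K : Type*} [Field K] {I : Ideal (MvPolynomial σ K)}
    {a b : σ →₀ ℕ} {s t : ℕ} (ha : MvPolynomial.monomial a 1 ∈ I ^ s)
    (hb : MvPolynomial.monomial b 1 ∈ I ^ t) : MvPolynomial.monomial (a + b) 1 ∈ I ^ (s + t) := by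
  rw [pow_add, ← mul_one (1 : K), ← MvPolynomial.monomial_mul]
  exact Ideal.mul_mem_mul ha hb

theorem monomial_nsmul_mem_pow {σ K : Type*} [Field K] {I : Ideal (MvPolynomial σ K)}
    {a : σ →₀ ℕ} (ha : MvPolynomial.monomial a 1 ∈ I) (s : ℕ) :
    MvPolynomial.monomial (s • a) 1 ∈ I ^ s := by
  rw [← one_pow (M := K) s, ← MvPolynomial.monomial_pow]
  exact Ideal.pow_mem_pow ha s

theorem monomial_windowExp_eq_prod {K : Type*} [Field K] (n m i : ℕ) :
    MvPolynomial.monomial (windowExp n m i) (1 : K) =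
      ∏ k ∈ (univ : Finset (Fin n)).filter (fun k => i ≤ k.val ∧ k.val < i + m),
        MvPolynomial.X k := by
  have : windowExp n m i =
      ∑ k ∈ (univ : Finset (Fin n)).filter (fun k => i ≤ k.val ∧ k.val < i + m),
        Finsupp.single k 1 := by
    ext k
    rw [windowExp_apply, Finsupp.finsetSum_apply]
    simp [Finsupp.single_apply]
  rw [this, MvPolynomial.monomial_sum_one]
  rfl

theorem monomial_windowExp_mem {K : Type*} [Field K] {n m i : ℕ} (hi : i + m ≤ n) :
    MvPolynomial.monomial (windowExp n m i) 1 ∈ pathIdeal K n m :=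
  Ideal.subset_span ⟨i, hi, monomial_windowExp_eq_prod n m i⟩

/-- The degree of a monomial in the variables of `Q`. -/
noncomputable def degreeOn {σ : Type*} (Q : Finset σ) : (σ →₀ ℕ) →+ ℕ :=
  ∑ k ∈ Q, Finsupp.applyAddHom k

theorem degreeOn_apply {σ : Type*} (Q : Finset σ) (b : σ →₀ ℕ) :
    degreeOn Q b = ∑ k ∈ Q, b k := by
  simp [degreeOn]

theorem degreeOn_single {σ : Type*} [DecidableEq σ] (Q : Finset σ) (k : σ) :
    degreeOn Q (Finsupp.single k 1) = if k ∈ Q then 1 else 0 := by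
  simp [degreeOn_apply, Finsupp.single_apply]

theorem degreeOn_windowExp {n m s : ℕ} (Q : Finset (Fin n)) {k₀ : Fin n} (hk₀ : k₀ ∈ Q)
    (hw : s ≤ k₀.val ∧ k₀.val < s + m)
    (huniq : ∀ k ∈ Q, s ≤ k.val → k.val < s + m → k = k₀) :
    degreeOn Q (windowExp n m s) = 1 := by
  rw [degreeOn_apply, Finset.sum_eq_single k₀, windowExp_apply, if_pos hw]
  · intro k hk hne
    rw [windowExp_apply, if_neg fun h => hne (huniq k hk h.1 h.2)]
  · exact fun h => absurd hk₀ h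

/-- If every window meets `Q`, then a monomial in the `t`-th power of the path ideal has degree at
least `t` in the variables of `Q`. -/
theorem le_degreeOn_of_monomial_mem_pow {K : Type*} [Field K] {n m t : ℕ} (Q : Finset (Fin n))
    (hQ : ∀ i, i + m ≤ n → ∃ k ∈ Q, i ≤ k.val ∧ k.val < i + m) {b : Fin n →₀ ℕ}
    (hb : MvPolynomial.monomial b 1 ∈ pathIdeal K n m ^ t) : t ≤ degreeOn Q b := by
  classical
  rw [degreeOn_apply]
  -- Under `φ` a monomial becomes `X` to its degree on `Q`, and the path ideal lands in `(X)`.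
  let φ : MvPolynomial (Fin n) K →ₐ[K] Polynomial K :=
    MvPolynomial.aeval fun k => if k ∈ Q then Polynomial.X else 1
  have h1 : pathIdeal K n m ≤ (Ideal.span {Polynomial.X}).comap φ := by
    refine Ideal.span_le.2 ?_
    rintro _ ⟨i, hi, rfl⟩
    obtain ⟨k, hkQ, hk⟩ := hQ i hi
    rw [SetLike.mem_coe, Ideal.mem_comap, Ideal.mem_span_singleton, map_prod]
    refine dvd_trans ?_ (Finset.dvd_prod_of_mem _ (mem_filter.2 ⟨mem_univ k, hk⟩))
    simp [φ, hkQ]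
  have h2 := (Ideal.pow_right_mono h1 t).trans (Ideal.le_comap_pow φ t) hb
  rw [Ideal.mem_comap, Ideal.span_singleton_pow, Ideal.mem_span_singleton] at h2
  have h3 : φ (MvPolynomial.monomial b 1) = Polynomial.X ^ ∑ k ∈ Q, b k := by
    rw [MvPolynomial.aeval_monomial, map_one, one_mul, Finsupp.prod_fintype _ _ (by simp)]
    simp only [ite_pow, one_pow]
    rw [Finset.prod_ite_mem, univ_inter, Finset.prod_pow_eq_pow_sum]
  rw [h3] at h2
  exact (pow_dvd_pow_iff Polynomial.X_ne_zero Polynomial.not_isUnit_X).1 h2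

/-- A set of representatives modulo `m` inside an interval of length `m` fills it. -/
theorem sum_varExp_eq_windowExp {n m s : ℕ} (f : ℕ → ℕ) (hmod : ∀ i < m, f i % m = i)
    (hs : ∀ i < m, s ≤ f i ∧ f i < s + m) : ∑ i ∈ range m, varExp n (f i) = windowExp n m s := by
  rw [windowExp_eq_sum_Ico]
  have hinj : Set.InjOn f (range m) := by
    intro i hi j hj h
    rw [coe_range, Set.mem_Iio] at hi hj
    rw [← hmod i hi, ← hmod j hj, h]
  rw [← Finset.sum_image (f := varExp n) (g := f) hinj]
  refine Finset.sum_congr (Finset.eq_of_subset_of_card_le ?_ ?_) fun _ _ => rfl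
  · intro j hj
    obtain ⟨i, hi, rfl⟩ := mem_image.1 hj
    exact mem_Ico.2 (hs i (mem_range.1 hi))
  · rw [Finset.card_image_of_injOn hinj]
    simp

/-- Induction by exchange: if the transversal uses `s`, trade it with window `s + 1` for window `s`
and the variable `s + m` of the same residue. Otherwise split off window `s + 1`. Either way the
remaining transversal avoids `s`. -/
theorem monomial_windows_add_transversal_mem {K : Type*} [Field K] {n m : ℕ} (hm : 0 < m) (r : ℕ) :
    ∀ (s : ℕ) (f : ℕ → ℕ), s + r + 1 + m ≤ n → (∀ i < m, f i % m = i) →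
      (∀ i < m, s ≤ f i ∧ f i < s + r + 1 + m) →
      MvPolynomial.monomial
        (∑ k ∈ range r, windowExp n m (s + k + 1) + ∑ i ∈ range m, varExp n (f i)) 1 ∈
        pathIdeal K n m ^ (r + 1) := by
  induction r with
  | zero =>
    intro s f hn hmod hs
    rw [sum_range_zero, zero_add, zero_add, pow_one]
    have hsm := Nat.mod_lt s hm
    -- Among the `m + 1` positions only `s` and `s + m` share a residue, so the transversal is
    -- window `s` or window `s + 1`.
    by_cases h : ∃ i < m, f i = s
    · obtain ⟨i₀, hi₀, h⟩ := h
      rw [sum_varExp_eq_windowExp (s := s) f hmod]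
      · exact monomial_windowExp_mem (by omega)
      · intro i hi
        have := hs i hi
        refine ⟨this.1, lt_of_not_ge fun h' => ?_⟩
        have h2 : f i = s + m := by omega
        have h3 := hmod i hi
        rw [h2, Nat.add_mod_right, ← h, hmod i₀ hi₀] at h3
        subst h3
        omega
    · rw [sum_varExp_eq_windowExp (s := s + 1) f hmod]
      · exact monomial_windowExp_mem (by omega)
      · intro i hi
        have := hs i hi
        have h2 : f i ≠ s := fun h' => h ⟨i, hi, h'⟩
        omega
  | succ r ih =>
    intro s f hn hmod hs
    have hsum : ∑ k ∈ range (r + 1), windowExp n m (s + k + 1) =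
        ∑ k ∈ range r, windowExp n m (s + 1 + k + 1) + windowExp n m (s + 1) := by
      rw [Finset.sum_range_succ']
      simp only [add_zero]
      congr 1
      exact sum_congr rfl fun k _ => by rw [add_right_comm s 1 k, add_assoc s k 1]
    by_cases h : ∃ i < m, f i = s
    · obtain ⟨i₀, hi₀, h⟩ := h
      let f' := Function.update f i₀ (s + m)
      have hf' : ∀ i, i ≠ i₀ → f' i = f i := fun i hi => Function.update_of_ne hi _ _
      have hf'₀ : f' i₀ = s + m := Function.update_self ..
      have key := ih (s + 1) f' (by omega) (fun i hi => by
          by_cases hii : i = i₀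
          · rw [hii, hf'₀, Nat.add_mod_right, ← h, hmod i₀ hi₀]
          · rw [hf' i hii, hmod i hi]) (fun i hi => by
          by_cases hii : i = i₀
          · rw [hii, hf'₀]; omega
          · rw [hf' i hii]
            have h1 := hs i hi
            have h2 : f i ≠ s := fun h' => hii (by rw [← hmod i hi, ← hmod i₀ hi₀, h, h'])
            omega)
      have hw := monomial_add_mem_pow key
        ((pow_one (pathIdeal K n m)).symm ▸ monomial_windowExp_mem (K := K) (i := s) (by omega))
      have hrest : ∑ i ∈ (range m).erase i₀, varExp n (f i) =
          ∑ i ∈ (range m).erase i₀, varExp n (f' i) :=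
        Finset.sum_congr rfl fun i hi => by rw [hf' i (ne_of_mem_erase hi)]
      have heq : ∑ k ∈ range (r + 1), windowExp n m (s + k + 1) + ∑ i ∈ range m, varExp n (f i) =
          ∑ k ∈ range r, windowExp n m (s + 1 + k + 1) + ∑ i ∈ range m, varExp n (f' i) +
            windowExp n m s := by
        have hshift := windowExp_succ_add n m s
        rw [hsum, ← Finset.add_sum_erase _ _ (mem_range.2 hi₀),
          ← Finset.add_sum_erase (range m) (fun i => varExp n (f' i)) (mem_range.2 hi₀), h, hf'₀,
          hrest]
        rw [add_assoc, ← add_assoc (windowExp n m (s + 1)), hshift]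
        abel
      rw [heq]
      exact hw
    · have key := ih (s + 1) f (by omega) hmod (fun i hi => by
        have h1 := hs i hi
        have h2 : f i ≠ s := fun h' => h ⟨i, hi, h'⟩
        omega)
      have hw := monomial_add_mem_pow key
        ((pow_one (pathIdeal K n m)).symm ▸
          monomial_windowExp_mem (K := K) (i := s + 1) (by omega))
      rw [hsum, add_right_comm (∑ k ∈ range r, windowExp n m (s + 1 + k + 1))]
      exact hw

/-! ### The two bounds -/

theorem exists_mod_eq_in_window {m c : ℕ} (hc : c < m) (s : ℕ) :
    ∃ q, s ≤ q ∧ q < s + m ∧ q % m = c := by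
  have hs := Nat.mod_lt s (by omega : 0 < m)
  have hd := Nat.div_add_mod s m
  by_cases h : s % m ≤ c
  · refine ⟨m * (s / m) + c, by omega, by omega, ?_⟩
    rw [Nat.mul_add_mod, Nat.mod_eq_of_lt hc]
  · refine ⟨m * (s / m) + (c + m), by omega, by omega, ?_⟩
    rw [Nat.mul_add_mod, Nat.add_mod_right, Nat.mod_eq_of_lt hc]

theorem eq_of_mod_eq_in_window {m s q q' : ℕ} (hq : s ≤ q ∧ q < s + m)
    (hq' : s ≤ q' ∧ q' < s + m) (h : q % m = q' % m) : q = q' := by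
  wlog hle : q ≤ q' generalizing q q'
  · exact (this hq' hq h.symm (by omega)).symm
  have h1 := Nat.sub_mod_eq_zero_of_mod_eq h.symm
  rw [Nat.mod_eq_of_lt (by omega)] at h1
  omega

theorem two_mul_sdepth_pathIdeal_pow_le {K : Type*} [Field K] {n m t : ℕ} (hm : 1 ≤ m)
    {t₀ : ℕ} (ht₀ : 1 ≤ t₀) (htt : t₀ ≤ t) (hn : t₀ + m ≤ n)
    (D : StanleyDecomposition (pathIdeal K n m ^ t)) : 2 * D.sdepth + t₀ ≤ 2 * n := by
  let V : Finset (Fin n) := univ.filter fun k => k.val < t₀ + m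
  let C : Fin m → Finset (Fin n) := fun i => V.filter fun k => k.val % m = i.val
  have hCmem : ∀ i k, k ∈ C i ↔ k.val < t₀ + m ∧ k.val % m = i.val := by simp [C, V]
  have hV : V.card = t₀ + m := by
    have := Fin.card_filter_val_lt (n := n) (m := t₀ + m)
    rwa [min_eq_right hn] at this
  have hCcard : ∑ i, (C i).card = t₀ + m := by
    rw [← hV]
    refine (Finset.card_eq_sum_card_fiberwise (f := fun k : Fin n => (⟨k.val % m,
      Nat.mod_lt _ hm⟩ : Fin m)) (t := univ) (fun _ _ => mem_coe.2 (mem_univ _))).trans ?_ |>.symm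
    simp [C, Fin.ext_iff]
  have hwin : ∀ (i : Fin m) (s : ℕ), s + m ≤ n →
      degreeOn (univ.filter fun k : Fin n => k.val % m = i.val) (windowExp n m s) = 1 := by
    intro i s hs
    obtain ⟨q, h1, h2, h3⟩ := exists_mod_eq_in_window i.2 s
    refine degreeOn_windowExp _ (k₀ := ⟨q, by omega⟩) (by simpa using h3) ⟨h1, h2⟩ ?_
    intro k hk hk1 hk2
    rw [mem_filter] at hk
    exact Fin.ext (eq_of_mod_eq_in_window ⟨hk1, hk2⟩ ⟨h1, h2⟩ (hk.2.trans h3.symm))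
  have key := D.two_mul_sdepth_le C ?_ ?_
    -- `w` is a product of `t - 1` windows: those starting at `1, …, t₀ - 1`, and window `0` as
    -- padding.
    (∑ k ∈ range (t₀ - 1), windowExp n m (0 + k + 1) + (t - t₀) • windowExp n m 0) ?_ ?_
  · rw [hCcard, Fintype.card_fin, Fintype.card_fin] at key
    omega
  · intro i j hij
    rw [Finset.disjoint_left]
    intro k hk hk'
    rw [hCmem] at hk hk'
    exact hij (Fin.ext (hk.2.symm.trans hk'.2))
  · intro i
    refine ⟨⟨i, by omega⟩, (hCmem _ _).2 ⟨?_, Nat.mod_eq_of_lt i.2⟩⟩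
    have := i.2
    change i.val < t₀ + m
    omega
  · intro f hf
    simp only [hCmem] at hf
    let g : ℕ → ℕ := fun i => if h : i < m then f ⟨i, h⟩ else 0
    have hg : ∀ i (h : i < m), g i = f ⟨i, h⟩ := fun i h => dif_pos h
    have hsum : ∑ i, Finsupp.single (f i) 1 = ∑ i ∈ range m, varExp n (g i) := by
      rw [Finset.sum_range]
      exact sum_congr rfl fun i _ => by rw [hg i i.2, varExp_val]
    have h1 := monomial_windows_add_transversal_mem (K := K) (n := n) hm (t₀ - 1) 0 g (by omega)
      (fun i hi => by rw [hg i hi]; exact (hf ⟨i, hi⟩).2)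
      (fun i hi => by rw [hg i hi]; have := (hf ⟨i, hi⟩).1; omega)
    have h2 := monomial_add_mem_pow h1
      (monomial_nsmul_mem_pow (monomial_windowExp_mem (K := K) (n := n) (m := m) (i := 0)
        (by omega)) (t - t₀))
    rw [show t₀ - 1 + 1 + (t - t₀) = t by omega, ← hsum] at h2
    rw [add_right_comm]
    exact h2
  -- Each window meets residue class `i` exactly once, so `v` has degree `t - 1` there.
  · intro f v i hf hv hmem
    simp only [hCmem] at hf
    have h1 := le_degreeOn_of_monomial_mem_pow
      (univ.filter fun k : Fin n => k.val % m = i.val) (fun s hs => by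
        obtain ⟨q, h1, h2, h3⟩ := exists_mod_eq_in_window i.2 s
        exact ⟨⟨q, by omega⟩, by simpa using h3, h1, h2⟩) hmem
    have h2 := congrArg (degreeOn (univ.filter fun k : Fin n => k.val % m = i.val)) hv
    rw [map_add, map_add, map_add, map_sum, map_sum, map_nsmul, hwin i 0 (by omega),
      Finset.sum_congr rfl fun k hk =>
        hwin i (0 + k + 1) (by have := mem_range.1 hk; omega)] at h2
    simp only [degreeOn_single, mem_filter, mem_univ, true_and, (hf _).2, ← Fin.ext_iff] at h2
    simp at h2
    omega

/-- `P` meets every window, and each point of `P` is the only point of `P` in some window: the one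
starting there (residue `0`) or ending there (residue `m`). -/
theorem sdepth_pathIdeal_pow_add_div_le {K : Type*} [Field K] {n m t : ℕ} (hm : 1 ≤ m)
    (hmn : m ≤ n) (ht : 1 ≤ t) (D : StanleyDecomposition (pathIdeal K n m ^ t)) :
    D.sdepth + n / (m + 1) ≤ n := by
  -- The condition `k.val + m ≤ n` ensures that the window starting at `k` exists.
  let P : Finset (Fin n) := univ.filter fun k =>
    (k.val % (m + 1) = 0 ∧ k.val + m ≤ n) ∨ k.val % (m + 1) = m
  have hP : ∀ k, k ∈ P ↔ (k.val % (m + 1) = 0 ∧ k.val + m ≤ n) ∨ k.val % (m + 1) = m := by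
    simp [P]
  have hz : (⟨0, by omega⟩ : Fin n) ∈ P := (hP _).2 (Or.inl ⟨Nat.zero_mod _, by simpa using hmn⟩)
  have hcard : 2 * (n / (m + 1)) ≤ P.card := by
    have hmul := Nat.mul_div_le n (m + 1)
    have hb : ∀ j : Fin (n / (m + 1)), (m + 1) * j.val + (m + 1) ≤ n := fun j =>
      (Nat.mul_le_mul_left (m + 1) (Nat.succ_le_of_lt j.2)).trans hmul
    let g : Fin (n / (m + 1)) × Bool → Fin n := fun x =>
      ⟨(m + 1) * x.1.val + (if x.2 then m else 0), by have := hb x.1; split_ifs <;> omega⟩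
    have hr : ∀ x : Bool, (if x then m else 0) < m + 1 := fun x => by split_ifs <;> omega
    have hg : Function.Injective g := by
      rintro ⟨j, x⟩ ⟨j', x'⟩ h
      have h' : (m + 1) * j.val + (if x then m else 0) =
        (m + 1) * j'.val + (if x' then m else 0) := congrArg Fin.val h
      have e1 := congrArg (· % (m + 1)) h'
      simp only [Nat.mul_add_mod, Nat.mod_eq_of_lt (hr _)] at e1
      rw [e1] at h'
      have e2 : j = j' := Fin.ext (Nat.eq_of_mul_eq_mul_left m.succ_pos (Nat.add_right_cancel h'))
      have e3 : x = x' := by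
        cases x <;> cases x' <;> simp at e1 ⊢ <;> omega
      rw [e2, e3]
    have hle := Finset.card_le_card_of_injOn (s := univ) (t := P) g (fun x _ => by
      rw [mem_coe, hP]
      have h1 := hb x.1
      rcases x with ⟨j, x⟩
      cases x
      · left; simp [g]; dsimp only at h1; omega
      · right; simp [g]) hg.injOn
    simp at hle
    omega
  have hw0 : degreeOn P (windowExp n m 0) = 1 := by
    refine degreeOn_windowExp P hz ⟨le_rfl, by simpa using Nat.lt_of_succ_le hm⟩
      fun k hk _ hk2 => Fin.ext ?_
    rw [hP, Nat.mod_eq_of_lt (by omega)] at hk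
    change k.val = 0
    omega
  -- All variables off `P` are supplied, so one variable of `P` completes a window; the degree of
  -- `w` on `P` is `t - 1`.
  set w : Fin n →₀ ℕ := ∑ k ∈ Pᶜ, Finsupp.single k 1 + (t - 1) • windowExp n m 0 with hw
  have key := D.two_mul_sdepth_le (fun _ : Unit => P) (fun i j h => absurd rfl h)
    (fun _ => ⟨_, hz⟩) w ?_ ?_
  · simp at key
    omega
  · intro f hf
    have hk := hf ()
    rw [Fintype.sum_unique, show (default : Unit) = () from rfl]
    generalize f () = k at hk
    obtain ⟨s, hs, hsk⟩ : ∃ s, s + m ≤ n ∧ ∀ l ∈ P, s ≤ l.val → l.val < s + m → l = k := by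
      have hd := Nat.div_add_mod k.val (m + 1)
      rcases (hP k).1 hk with ⟨h1, h2⟩ | h1
      · refine ⟨k.val, h2, fun l hl h3 h4 => Fin.ext ?_⟩
        have h5 : l.val % (m + 1) = l.val - k.val := by
          rw [show l.val = (m + 1) * (k.val / (m + 1)) + (l.val - k.val) by omega,
            Nat.mul_add_mod, Nat.mod_eq_of_lt (by omega)]
          omega
        rw [hP] at hl
        omega
      · refine ⟨k.val + 1 - m, by have := k.2; omega, fun l hl h3 h4 => Fin.ext ?_⟩
        have h5 : l.val % (m + 1) = l.val + m - k.val := by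
          rw [show l.val = (m + 1) * (k.val / (m + 1)) + (l.val + m - k.val) by omega,
            Nat.mul_add_mod, Nat.mod_eq_of_lt (by omega)]
          omega
        rw [hP] at hl
        omega
    have h1 : windowExp n m s ≤ ∑ k ∈ Pᶜ, Finsupp.single k 1 + Finsupp.single k 1 := by
      intro l
      rw [windowExp_apply]
      split_ifs with h
      · rw [Finsupp.add_apply, Finsupp.finsetSum_apply]
        by_cases hl : l ∈ P
        · simp [hsk l hl h.1 h.2]
        · simp [Finsupp.single_apply, hl]
      · exact Nat.zero_le _
    have h2 := monomial_add_mem_pow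
      ((pow_one (pathIdeal K n m)).symm ▸ monomial_mem_mono (monomial_windowExp_mem (K := K) hs) h1)
      (monomial_nsmul_mem_pow (monomial_windowExp_mem (K := K) (n := n) (m := m) (i := 0)
        (by omega)) (t - 1))
    rw [show 1 + (t - 1) = t by omega] at h2
    rw [hw, add_right_comm]
    exact h2
  · intro f v i _ hv hmem
    rw [Fintype.sum_unique, show (default : Unit) = i from rfl] at hv
    rw [← add_right_cancel hv] at hmem
    have h1 := le_degreeOn_of_monomial_mem_pow P (fun s hs => by
      have hd := Nat.div_add_mod s (m + 1)
      have hlt : s % (m + 1) < m + 1 := Nat.mod_lt s m.succ_pos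
      by_cases h : s % (m + 1) = 0
      · exact ⟨⟨s, by omega⟩, (hP _).2 (Or.inl ⟨h, hs⟩), le_rfl,
          by simpa using Nat.lt_of_succ_le hm⟩
      · refine ⟨⟨(m + 1) * (s / (m + 1)) + m, by omega⟩, (hP _).2 (Or.inr ?_), ?_, ?_⟩
        · simp
        · change s ≤ (m + 1) * (s / (m + 1)) + m
          omega
        · change (m + 1) * (s / (m + 1)) + m < s + m
          omega) hmem
    have h2 : degreeOn P (∑ k ∈ Pᶜ, Finsupp.single k 1) = 0 := by
      rw [map_sum]
      refine Finset.sum_eq_zero fun k hk => ?_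
      rw [degreeOn_single, if_neg (mem_compl.1 hk)]
    rw [hw, map_add, map_nsmul, h2, hw0] at h1
    simp at h1
    omega

theorem theorem4p3 (K : Type*) [Field K] (n m t t₀ : ℕ) (hm : 1 ≤ m) (hmn : m ≤ n) (ht : 1 ≤ t)
    (ht₀ : t₀ = min t (n - m)) :
    (stanleyDepth (pathIdeal K n m ^ t) : ℤ) ≤
      min ((n : ℤ) - ⌈(t₀ : ℚ) / 2⌉)
        ((n : ℤ) - ⌊((n : ℚ) - (t₀ : ℚ) + 1) / ((m : ℚ) + 1)⌋ + 1) := by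
  rcases hmn.eq_or_lt with rfl | hlt
  -- For `n = m` both bounds equal `n`.
  · have h0 : t₀ = 0 := by omega
    have h : stanleyDepth (pathIdeal K m m ^ t) ≤ m :=
      stanleyDepth_le_of_forall fun D => by simpa using D.sdepth_le_card
    have hne : (m : ℚ) + 1 ≠ 0 := by positivity
    simp [h0, div_self hne, h]
  · have h1 : stanleyDepth (pathIdeal K n m ^ t) ≤ (2 * n - t₀) / 2 :=
      stanleyDepth_le_of_forall fun D => by
        have := two_mul_sdepth_pathIdeal_pow_le hm (t₀ := t₀) (by omega) (by omega) (by omega) D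
        omega
    have h2 : stanleyDepth (pathIdeal K n m ^ t) ≤ n - n / (m + 1) :=
      stanleyDepth_le_of_forall fun D => by
        have := sdepth_pathIdeal_pow_add_div_le hm hmn ht D
        omega
    generalize stanleyDepth (pathIdeal K n m ^ t) = k at h1 h2
    have h1' : 2 * k + t₀ ≤ 2 * n := by omega
    have hd : n / (m + 1) ≤ n := Nat.div_le_self _ _
    have h2' : k + n / (m + 1) ≤ n := by omega
    have ht₀' : 1 ≤ t₀ := by omega
    refine le_min ?_ ?_
    · have : ⌈(t₀ : ℚ) / 2⌉ ≤ (n : ℤ) - k := by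
        rw [Int.ceil_le, div_le_iff₀ two_pos]
        push_cast
        have : (2 * k + t₀ : ℚ) ≤ 2 * n := by exact_mod_cast h1'
        linarith
      linarith
    -- Since `t₀ ≥ 1`, the floor is at most `n / (m + 1)`, so `h2'` suffices with one to spare.
    · have : ⌊((n : ℚ) - (t₀ : ℚ) + 1) / ((m : ℚ) + 1)⌋ < (n : ℤ) - k + 2 := by
        rw [Int.floor_lt, div_lt_iff₀ (by positivity)]
        push_cast
        have e1 : (n : ℚ) < (m + 1) * ((n / (m + 1) : ℕ) + 1) := by
          exact_mod_cast Nat.lt_mul_div_succ n (Nat.succ_pos m)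
        have e2 : (k : ℚ) + (n / (m + 1) : ℕ) ≤ n := by exact_mod_cast h2'
        have e3 : (1 : ℚ) ≤ t₀ := by exact_mod_cast ht₀'
        have e4 : (0 : ℚ) < m + 1 := by positivity
        nlinarith
      linarith
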